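/- Throughout, vector spaces are real and finite-dimensional. For a normed space $X$ let $\mathcal{C}_X=\{(t,x)\in\mathbb{R}\times X : t\ge \|x\|\}$, and for $n\in\mathbb{N}$ let $\mathcal{L}_n=\mathcal{C}_{\ell_2^n}\subseteq\mathbb{R}\times\ell_2^n\cong\mathbb{R}^{n+1}$ be the Lorentz cone, where $\ell_2^n=(\mathbb{R}^n,\|\cdot\|_2)$; write $e_0=(1,0),e_1,\dots,e_n$ for the standard basis of $\mathbb{R}\times\ell_2^n$. For convex cones $\mathcal{C}\subseteq\mathcal{V}$ and $\mathcal{D}\subseteq\mathcal{W}$ let $\mathrm{Pos}(\mathcal{C},\mathcal{D})$ be the set of linear maps $P:\mathcal{V}\to\mathcal{W}$ with $P(\mathcal{C})\subseteq\mathcal{D}$, let $\mathcal{C}\otimes_{\min}\mathcal{D}=\mathrm{conv}\{x\otimes y : x\in\mathcal{C},\,y\in\mathcal{D}\}$ be the minimal tensor product, and let $$\mathcal{C}\otimes_L\mathcal{D}=\mathrm{conv}\Big\{(A\otimes B)\Big(\sum_{i=0}^k e_i\otimes e_i\Big) : k\in\mathbb{N},\ A\in\mathrm{Pos}(\mathcal{L}_k,\mathcal{C}),\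 B\in\mathrm{Pos}(\mathcal{L}_k,\mathcal{D})\Big\}$$ be the Lorentzian tensor product. A map $P\in\mathrm{Pos}(\mathcal{C},\mathcal{D})$ is called Lorentz-entanglement annihilating from $\mathcal{C}$ to $\mathcal{D}$ if $(P\otimes P)(\mathcal{C}\otimes_L\mathcal{C})\subseteq\mathcal{D}\otimes_{\min}\mathcal{D}$. For a linear map $u:X\to Y$ of normed spaces, the $2$-summing norm $\pi_2(u)$ is the smallest $C\ge 0$ such that $$\Big(\sum_i\|u(x_i)\|^2\Big)^{1/2}\le C\,\max_{f\in X^*,\ \|f\|\le 1}\Big(\sum_i|f(x_i)|^2\Big)^{1/2}$$ for every finite family $(x_i)$ in $X$. **Theorem.** Let $X$ be a finite-dimensional normed space, $n\in\mathbb{N}$, $u:X\to\ell_2^n$ a linear map and $\lambda\in\mathbb{R}$. The central map $\lambda\oplus u:\mathbb{R}\times X\to\mathbb{R}\times\ell_2^n$, $(t,x)\mapsto(\lambda t,u(x))$, is Lorentz-entanglement annihilating from $\mathcal{C}_X$ to $\mathcal{L}_n$ if and only if $\pi_2(u)\le\lambda$. -/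

import Mathlib

open scoped TensorProduct

noncomputable section

namespace LorentzEntanglement

/-- The cone `{(t, x) ∈ ℝ × X : ‖x‖ ≤ t}` over a normed space `X`. -/
def normCone (X : Type*) [NormedAddCommGroup X] [NormedSpace ℝ X] : PointedCone ℝ (ℝ × X) where
  carrier := {p | ‖p.2‖ ≤ p.1}
  add_mem' {a b} ha hb := (norm_add_le a.2 b.2).trans (add_le_add ha hb)
  zero_mem' := by simp
  smul_mem' := by
    intro c p hp
    have h : ‖(c : ℝ) • p.2‖ ≤ (c : ℝ) * p.1 := by
      rw [norm_smul, Real.norm_of_nonneg c.2]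
      exact mul_le_mul_of_nonneg_left hp c.2
    exact h

/-- The Lorentz cone in `ℝ × ℓ₂ⁿ`. -/
def lorentzCone (n : ℕ) : PointedCone ℝ (ℝ × EuclideanSpace ℝ (Fin n)) :=
  normCone (EuclideanSpace ℝ (Fin n))

/-- Linear maps that send the cone `C` into the cone `D`. -/
def IsPositiveMap {V W : Type*} [AddCommGroup V] [Module ℝ V] [AddCommGroup W] [Module ℝ W]
    (C : PointedCone ℝ V) (D : PointedCone ℝ W) (P : V →ₗ[ℝ] W) : Prop :=
  ∀ x ∈ C, P x ∈ D

/-- The identity tensor `∑ᵢ eᵢ ⊗ eᵢ`, `i = 0, …, k`, for the standard basis `e₀ = (1, 0)`,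
`eᵢ = (0, eᵢ)` of `ℝ × ℓ₂ᵏ`. -/
def identityTensor (k : ℕ) :
    (ℝ × EuclideanSpace ℝ (Fin k)) ⊗[ℝ] (ℝ × EuclideanSpace ℝ (Fin k)) :=
  ((1 : ℝ), (0 : EuclideanSpace ℝ (Fin k))) ⊗ₜ[ℝ] ((1 : ℝ), (0 : EuclideanSpace ℝ (Fin k))) +
    ∑ i : Fin k, ((0 : ℝ), EuclideanSpace.single i (1 : ℝ)) ⊗ₜ[ℝ]
      ((0 : ℝ), EuclideanSpace.single i (1 : ℝ))

/-- The Lorentzian tensor product of two cones: the convex hull of the tensors `(A ⊗ B) Îₖ`, for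
`k ∈ ℕ` and positive maps `A`, `B` from the `k`-th Lorentz cone into the two cones. -/
def lorentzTensorProduct {V W : Type*} [AddCommGroup V] [Module ℝ V] [AddCommGroup W] [Module ℝ W]
    (C : PointedCone ℝ V) (D : PointedCone ℝ W) : Set (V ⊗[ℝ] W) :=
  convexHull ℝ {z | ∃ (k : ℕ) (A : (ℝ × EuclideanSpace ℝ (Fin k)) →ₗ[ℝ] V)
    (B : (ℝ × EuclideanSpace ℝ (Fin k)) →ₗ[ℝ] W),
    IsPositiveMap (lorentzCone k) C A ∧ IsPositiveMap (lorentzCone k) D B ∧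
      z = TensorProduct.map A B (identityTensor k)}

/-- `P` is Lorentz-entanglement annihilating: it is positive, and `P ⊗ P` sends the Lorentzian
tensor product `C ⊗_L C` into the minimal tensor product `D ⊗_min D`. -/
def IsLorentzEntanglementAnnihilating {V W : Type*} [AddCommGroup V] [Module ℝ V]
    [AddCommGroup W] [Module ℝ W] (C : PointedCone ℝ V) (D : PointedCone ℝ W)
    (P : V →ₗ[ℝ] W) : Prop :=
  IsPositiveMap C D P ∧
    ∀ z ∈ lorentzTensorProduct C C, TensorProduct.map P P z ∈ PointedCone.minTensorProduct D D

/-- The central map `c ⊕ u : (t, x) ↦ (c t, u x)`. -/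
def centralMap {X Y : Type*} [AddCommGroup X] [Module ℝ X] [AddCommGroup Y] [Module ℝ Y]
    (c : ℝ) (u : X →ₗ[ℝ] Y) : (ℝ × X) →ₗ[ℝ] (ℝ × Y) :=
  (c • LinearMap.id).prodMap u

/-- `C ≥ 0` is a 2-summing constant of `u`: for all finite families `x₁, …, xₘ` in `X`,
`(∑ ‖u xᵢ‖²)^(1/2) ≤ C sup_{‖f‖ ≤ 1} (∑ |f xᵢ|²)^(1/2)`. -/
def IsTwoSummingConstant {X Y : Type*} [NormedAddCommGroup X] [NormedSpace ℝ X]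
    [NormedAddCommGroup Y] [NormedSpace ℝ Y] (u : X →ₗ[ℝ] Y) (C : ℝ) : Prop :=
  0 ≤ C ∧ ∀ (m : ℕ) (x : Fin m → X),
    √(∑ i, ‖u (x i)‖ ^ 2) ≤
      C * ⨆ f : {f : X →L[ℝ] ℝ // ‖f‖ ≤ 1}, √(∑ i, |f.1 (x i)| ^ 2)

/-- The 2-summing norm `π₂(u)`: the smallest 2-summing constant of `u`. -/
def twoSummingNorm {X Y : Type*} [NormedAddCommGroup X] [NormedSpace ℝ X]
    [NormedAddCommGroup Y] [NormedSpace ℝ Y] (u : X →ₗ[ℝ] Y) : ℝ :=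
  sInf {C | IsTwoSummingConstant u C}

/-- On a finite-dimensional space, the infimum in the definition of the 2-summing norm is
attained, so `π₂(u)` is indeed the smallest 2-summing constant. -/
theorem isLeast_twoSummingNorm {X Y : Type*} [NormedAddCommGroup X] [NormedSpace ℝ X]
    [FiniteDimensional ℝ X] [NormedAddCommGroup Y] [NormedSpace ℝ Y] (u : X →ₗ[ℝ] Y) :
    IsLeast {C | IsTwoSummingConstant u C} (twoSummingNorm u) := by
  have hbdd : ∀ (m : ℕ) (x : Fin m → X), BddAbove (Set.range
      fun f : {f : X →L[ℝ] ℝ // ‖f‖ ≤ 1} => √(∑ i, |f.1 (x i)| ^ 2)) := by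
    intro m x
    refine ⟨√(∑ i, ‖x i‖ ^ 2), ?_⟩
    rintro _ ⟨f, rfl⟩
    refine Real.sqrt_le_sqrt (Finset.sum_le_sum fun i _ => ?_)
    refine pow_le_pow_left₀ (abs_nonneg _) ?_ 2
    exact (f.1.le_opNorm (x i)).trans (mul_le_of_le_one_left (norm_nonneg _) f.2)
  have hsup : ∀ (m : ℕ) (x : Fin m → X), 0 ≤ ⨆ f : {f : X →L[ℝ] ℝ // ‖f‖ ≤ 1},
      √(∑ i, |f.1 (x i)| ^ 2) := fun m x => Real.iSup_nonneg fun f => Real.sqrt_nonneg _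
  have hne : {C | IsTwoSummingConstant u C}.Nonempty := by
    let b := Module.finBasis ℝ X
    let d := Module.finrank ℝ X
    let g : Fin d → (X →L[ℝ] ℝ) := fun j => LinearMap.toContinuousLinearMap (b.coord j)
    let K : ℝ := √(d * ∑ j, (‖g j‖ * ‖u (b j)‖) ^ 2)
    refine ⟨K, Real.sqrt_nonneg _, fun m x => ?_⟩
    set S := ⨆ f : {f : X →L[ℝ] ℝ // ‖f‖ ≤ 1}, √(∑ i, |f.1 (x i)| ^ 2) with hS
    have hg : ∀ j, ∑ i, (g j (x i)) ^ 2 ≤ ‖g j‖ ^ 2 * S ^ 2 := by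
      intro j
      rcases eq_or_ne (g j) 0 with h0 | h0
      · simp [h0]
      · have hn : 0 < ‖g j‖ := norm_pos_iff.mpr h0
        have h1 : √(∑ i, |(‖g j‖⁻¹ • g j) (x i)| ^ 2) ≤ S :=
          le_ciSup (hbdd m x) ⟨‖g j‖⁻¹ • g j, by
            rw [norm_smul, norm_inv, norm_norm, inv_mul_cancel₀ hn.ne']⟩
        have h2 := (Real.sqrt_le_left (hsup m x)).mp h1
        have h3 : ∑ i, (g j (x i)) ^ 2 =
            ‖g j‖ ^ 2 * ∑ i, |(‖g j‖⁻¹ • g j) (x i)| ^ 2 := by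
          rw [Finset.mul_sum]
          refine Finset.sum_congr rfl fun i _ => ?_
          simp only [sq_abs, _root_.smul_apply, smul_eq_mul]
          field_simp
        rw [h3]
        exact mul_le_mul_of_nonneg_left h2 (sq_nonneg _)
    have hu : ∀ i, ‖u (x i)‖ ^ 2 ≤ d * ∑ j, (g j (x i)) ^ 2 * ‖u (b j)‖ ^ 2 := by
      intro i
      have e : u (x i) = ∑ j, (g j (x i)) • u (b j) := by
        conv_lhs => rw [← b.sum_repr (x i)]
        simp only [map_sum, map_smul]
        rfl
      have h1 : ‖u (x i)‖ ≤ ∑ j, |g j (x i)| * ‖u (b j)‖ := by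
        rw [e]
        refine (norm_sum_le _ _).trans (le_of_eq ?_)
        simp [norm_smul]
      refine (pow_le_pow_left₀ (norm_nonneg _) h1 2).trans ?_
      refine (sq_sum_le_card_mul_sum_sq (s := Finset.univ)).trans (le_of_eq ?_)
      simp [mul_pow]
    have hfin : ∑ i, ‖u (x i)‖ ^ 2 ≤ (d * ∑ j, (‖g j‖ * ‖u (b j)‖) ^ 2) * S ^ 2 := by
      refine (Finset.sum_le_sum fun i _ => hu i).trans ?_
      rw [← Finset.mul_sum, Finset.sum_comm, mul_assoc, Finset.sum_mul]
      refine mul_le_mul_of_nonneg_left (Finset.sum_le_sum fun j _ => ?_) (Nat.cast_nonneg _)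
      rw [← Finset.sum_mul]
      calc (∑ i, g j (x i) ^ 2) * ‖u (b j)‖ ^ 2 ≤ (‖g j‖ ^ 2 * S ^ 2) * ‖u (b j)‖ ^ 2 :=
            mul_le_mul_of_nonneg_right (hg j) (sq_nonneg _)
        _ = (‖g j‖ * ‖u (b j)‖) ^ 2 * S ^ 2 := by ring
    refine (Real.sqrt_le_sqrt hfin).trans (le_of_eq ?_)
    rw [Real.sqrt_mul (by positivity), Real.sqrt_sq (hsup m x)]
  have hlb : BddBelow {C | IsTwoSummingConstant u C} := ⟨0, fun C hC => hC.1⟩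
  refine ⟨⟨le_csInf hne fun C hC => hC.1, fun m x => ?_⟩, fun C hC => csInf_le hlb hC⟩
  rcases (hsup m x).eq_or_lt with h0 | h0
  · obtain ⟨C, hC⟩ := hne
    have := hC.2 m x
    rw [← h0, mul_zero] at this ⊢
    exact this
  · rw [← div_le_iff₀ h0]
    exact le_csInf hne fun C hC => (div_le_iff₀ h0).mpr (hC.2 m x)

end LorentzEntanglement

end

open scoped TensorProduct

namespace LorentzEntanglement

/-! Write `P` for `λ ⊕ u`, `η` for the Lorentz form `s t - ⟨x, y⟩`, and `e` for the standard basis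
vectors.

Necessity: given `x₁, …, xₘ` with supremum `s` in the 2-summing inequality, the map `D : ℓ₂ᵐ → X`,
`eᵢ ↦ xᵢ`, has norm at most `s`, so `s ⊕ D` is positive. Pairing `η`, which is nonnegative on the
minimal tensor product, with the resulting tensor gives `λ² s² - ∑ ‖u xᵢ‖² ≥ 0`.

Sufficiency: by cone duality it is enough to test against forms `η(Q ·, ·)` with `Q` positive, that
is, to show `∑ η(Q P A e, P B e) ≥ 0`. The diagonal case `∑ η(P A e, P A e) ≥ 0` is the 2-summing
inequality combined with self-duality of the Lorentz cone, and the S-lemma bound `η(Q x, Q x) ≥ τ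
η(x, x)` carries it through `Q`. The mixed sum follows by the Cauchy–Schwarz argument of
`sum_inner_le_sum_mul`. Its obstacle is that the two time functionals need not be parallel. A
symmetric boost `H` with inverse `H'` makes them parallel, and `H ⊗ H'` fixes the identity tensor,
so the mixed sum does not change. -/

/-! ### The S-lemma -/

/-- Homogeneous S-lemma for quadratic forms given by bilinear maps. -/
theorem exists_mul_le_of_nonneg_imp {E : Type*} [AddCommGroup E] [Module ℝ E]
    (q p : E →ₗ[ℝ] E →ₗ[ℝ] ℝ) (hq : ∃ x, 0 < q x x) (h : ∀ x, 0 ≤ q x x → 0 ≤ p x x) :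
    ∃ τ : ℝ, 0 ≤ τ ∧ ∀ x, τ * q x x ≤ p x x := by
  have key : ∀ x y, 0 < q x x → q y y < 0 → 0 ≤ q x x * p y y - q y y * p x x := by
    intro x y hx hy
    set a := q x x
    set d := - q y y with hd
    set b := q x y + q y x with hb
    have hd0 : 0 < d := by linarith
    set r := √(b ^ 2 + 4 * a * d) with hr
    have hr2 : r ^ 2 = b ^ 2 + 4 * a * d := Real.sq_sqrt (by positivity)
    have hrb : |b| < r := by
      refine lt_of_pow_lt_pow_left₀ 2 (Real.sqrt_nonneg _) ?_
      rw [hr2, sq_abs]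
      have : 0 < a * d := mul_pos hx hd0
      linarith
    have hb1 := (abs_lt.mp hrb).1
    have hb2 := (abs_lt.mp hrb).2
    have hexp : ∀ (f : E →ₗ[ℝ] E →ₗ[ℝ] ℝ) (s : ℝ), f (x + s • y) (x + s • y) =
        f x x + s * (f x y + f y x) + s ^ 2 * f y y := by
      intro f s
      simp only [map_add, LinearMap.add_apply, map_smul, LinearMap.smul_apply, smul_eq_mul]
      ring
    -- The line `x + s • y` meets the null cone of `q` at `s = β` and `s = -γ`. Weighting the values
    -- of `p` there by `γ` and `β` cancels the cross term.
    set β := (b + r) / (2 * d) with hβ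
    set γ := (r - b) / (2 * d) with hγ
    have hβ0 : 0 < β := div_pos (by linarith) (by linarith)
    have hγ0 : 0 < γ := div_pos (by linarith) (by linarith)
    have hβγ : β * γ * d = a := by
      rw [hβ, hγ]; field_simp; linarith
    have h1 : 0 ≤ p (x + β • y) (x + β • y) := by
      refine h _ (le_of_eq ?_)
      rw [hexp, show q y y = -d by simp [hd], ← hb, hβ]
      field_simp; linear_combination hr2
    have h2 : 0 ≤ p (x + (-γ) • y) (x + (-γ) • y) := by
      refine h _ (le_of_eq ?_)
      rw [hexp, show q y y = -d by simp [hd], ← hb, hγ]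
      field_simp; linear_combination hr2
    rw [hexp] at h1 h2
    have h3 : 0 ≤ (β + γ) * (p x x + β * γ * p y y) := by
      have := add_nonneg (mul_nonneg hγ0.le h1) (mul_nonneg hβ0.le h2)
      refine this.trans (le_of_eq ?_)
      ring
    have h4 : 0 ≤ p x x + β * γ * p y y := nonneg_of_mul_nonneg_right h3 (by positivity)
    have h5 := mul_nonneg hd0.le h4
    have h6 : d * (p x x + β * γ * p y y) = d * p x x + a * p y y := by
      rw [← hβγ]; ring
    have : q y y = -d := by simp [hd]
    rw [this]; linarith
  let s : Set ℝ := (fun x => p x x / q x x) '' {x | 0 < q x x}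
  have hs : s.Nonempty := Set.Nonempty.image _ hq
  have hlb : ∀ t ∈ s, 0 ≤ t := by
    rintro _ ⟨x, hx, rfl⟩
    exact div_nonneg (h x (le_of_lt hx)) (le_of_lt hx)
  -- The largest `τ` allowed by the vectors with `q > 0`; `key` says it also serves those with `q <
  -- 0`.
  refine ⟨sInf s, le_csInf hs hlb, fun y => ?_⟩
  rcases lt_trichotomy (q y y) 0 with hy | hy | hy
  · rw [← div_le_iff_of_neg hy]
    refine le_csInf hs ?_
    rintro _ ⟨x, hx, rfl⟩
    have hx' : 0 < q x x := hx
    have := key x y hx' hy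
    change p y y / q y y ≤ p x x / q x x
    rw [div_le_iff_of_neg hy, div_mul_eq_mul_div, div_le_iff₀ hx']
    linarith
  · rw [hy, mul_zero]
    exact h y hy.ge
  · rw [← le_div_iff₀ hy]
    exact csInf_le ⟨0, hlb⟩ ⟨y, hy, rfl⟩

/-! ### Euclidean structure and self-duality of the Lorentz cone -/

/-- The standard basis `e₀ = (1, 0)`, `eᵢ = (0, eᵢ)` of `ℝ × ℓ₂ᵏ`. -/
noncomputable def stdVec (k : ℕ) : Option (Fin k) → ℝ × EuclideanSpace ℝ (Fin k)
  | none => (1, 0)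
  | some i => (0, EuclideanSpace.single i 1)

/-- The Euclidean inner product on `ℝ × ℓ₂ᵏ`. -/
noncomputable def dot {k : ℕ} (x y : ℝ × EuclideanSpace ℝ (Fin k)) : ℝ :=
  x.1 * y.1 + inner ℝ x.2 y.2

variable {k : ℕ}

theorem dot_comm (x y : ℝ × EuclideanSpace ℝ (Fin k)) : dot x y = dot y x := by
  simp only [dot, real_inner_comm, mul_comm]

theorem mem_lorentzCone {x : ℝ × EuclideanSpace ℝ (Fin k)} :
    x ∈ lorentzCone k ↔ ‖x.2‖ ≤ x.1 := Iff.rfl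

theorem dot_nonneg {x y : ℝ × EuclideanSpace ℝ (Fin k)} (hx : x ∈ lorentzCone k)
    (hy : y ∈ lorentzCone k) : 0 ≤ dot x y := by
  rw [mem_lorentzCone] at hx hy
  have h1 := abs_le.mp (abs_real_inner_le_norm x.2 y.2)
  have h2 := mul_le_mul hx hy (norm_nonneg _) ((norm_nonneg _).trans hx)
  unfold dot
  linarith [h1.1]

theorem sum_dot_stdVec_smul (x : ℝ × EuclideanSpace ℝ (Fin k)) :
    ∑ o, dot (stdVec k o) x • stdVec k o = x := by
  rw [Fintype.sum_option]
  refine Prod.ext ?_ ?_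
  · simp [stdVec, dot, Prod.fst_sum]
  · ext j
    simp [stdVec, dot, Prod.snd_sum, EuclideanSpace.inner_single_left, Finset.sum_apply,
      Pi.single_apply]

theorem identityTensor_eq_sum (k : ℕ) :
    identityTensor k = ∑ o, stdVec k o ⊗ₜ[ℝ] stdVec k o := by
  rw [Fintype.sum_option]; rfl

/-- The vector representing a linear functional with respect to `dot`. -/
noncomputable def repr (α : (ℝ × EuclideanSpace ℝ (Fin k)) →ₗ[ℝ] ℝ) :
    ℝ × EuclideanSpace ℝ (Fin k) := ∑ o, α (stdVec k o) • stdVec k o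

theorem dot_sum_smul {ι : Type*} (s : Finset ι) (c : ι → ℝ)
    (v : ι → ℝ × EuclideanSpace ℝ (Fin k)) (x : ℝ × EuclideanSpace ℝ (Fin k)) :
    dot (∑ i ∈ s, c i • v i) x = ∑ i ∈ s, c i * dot (v i) x := by
  simp only [dot, Prod.fst_sum, Prod.snd_sum, Prod.smul_fst, Prod.smul_snd, sum_inner,
    real_inner_smul_left, smul_eq_mul, Finset.sum_mul, ← Finset.sum_add_distrib]
  exact Finset.sum_congr rfl fun i _ => by ring

theorem dot_repr (α : (ℝ × EuclideanSpace ℝ (Fin k)) →ₗ[ℝ] ℝ)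
    (x : ℝ × EuclideanSpace ℝ (Fin k)) : dot (repr α) x = α x := by
  rw [repr, dot_sum_smul]
  conv_rhs => rw [← sum_dot_stdVec_smul x, map_sum]
  simp only [map_smul, smul_eq_mul, mul_comm]

theorem sum_mul_eq_dot (α β : (ℝ × EuclideanSpace ℝ (Fin k)) →ₗ[ℝ] ℝ) :
    ∑ o, α (stdVec k o) * β (stdVec k o) = dot (repr α) (repr β) := by
  rw [dot_repr, repr, map_sum]
  simp only [map_smul, smul_eq_mul, mul_comm]

theorem mem_lorentzCone_of_dot_nonneg {a : ℝ × EuclideanSpace ℝ (Fin k)}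
    (h : ∀ x ∈ lorentzCone k, 0 ≤ dot a x) : a ∈ lorentzCone k := by
  have h0 : 0 ≤ a.1 := by
    have := h (1, 0) (by simp [mem_lorentzCone])
    simpa [dot] using this
  -- The boundary ray on which `dot a` is smallest.
  have h1 := h (‖a.2‖, -a.2) (by simp [mem_lorentzCone])
  simp only [dot, inner_neg_right, real_inner_self_eq_norm_sq] at h1
  rw [mem_lorentzCone]
  rcases (norm_nonneg a.2).eq_or_lt with h2 | h2
  · rwa [← h2]
  · nlinarith

theorem repr_mem_lorentzCone {α : (ℝ × EuclideanSpace ℝ (Fin k)) →ₗ[ℝ] ℝ}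
    (h : ∀ x ∈ lorentzCone k, 0 ≤ α x) : repr α ∈ lorentzCone k :=
  mem_lorentzCone_of_dot_nonneg fun x hx => by rw [dot_repr]; exact h x hx

theorem sum_mul_nonneg {α β : (ℝ × EuclideanSpace ℝ (Fin k)) →ₗ[ℝ] ℝ}
    (hα : ∀ x ∈ lorentzCone k, 0 ≤ α x) (hβ : ∀ x ∈ lorentzCone k, 0 ≤ β x) :
    0 ≤ ∑ o, α (stdVec k o) * β (stdVec k o) := by
  rw [sum_mul_eq_dot]
  exact dot_nonneg (repr_mem_lorentzCone hα) (repr_mem_lorentzCone hβ)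

/-- In the standard basis the two sides have as coefficients the matrix of `H` and its transpose. -/
theorem map_identityTensor_comm {H : (ℝ × EuclideanSpace ℝ (Fin k)) →ₗ[ℝ] _}
    (hH : ∀ x y, dot (H x) y = dot x (H y)) :
    TensorProduct.map H LinearMap.id (identityTensor k) =
      TensorProduct.map LinearMap.id H (identityTensor k) := by
  simp only [identityTensor_eq_sum, map_sum, TensorProduct.map_tmul, LinearMap.id_apply]
  have h1 : ∀ o, H (stdVec k o) ⊗ₜ[ℝ] stdVec k o =
      ∑ j, dot (stdVec k j) (H (stdVec k o)) • stdVec k j ⊗ₜ[ℝ] stdVec k o := by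
    intro o
    conv_lhs => rw [← sum_dot_stdVec_smul (H (stdVec k o)), TensorProduct.sum_tmul]
    simp only [TensorProduct.smul_tmul']
  have h2 : ∀ o, stdVec k o ⊗ₜ[ℝ] H (stdVec k o) =
      ∑ j, dot (stdVec k j) (H (stdVec k o)) • stdVec k o ⊗ₜ[ℝ] stdVec k j := by
    intro o
    conv_lhs => rw [← sum_dot_stdVec_smul (H (stdVec k o)), TensorProduct.tmul_sum]
    simp only [TensorProduct.tmul_smul]
  simp only [h1, h2]
  rw [Finset.sum_comm]
  refine Finset.sum_congr rfl fun i _ => Finset.sum_congr rfl fun j _ => ?_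
  rw [← hH, dot_comm]

/-! ### Lorentz boosts -/

/-- The symmetric Lorentz boost with time direction `(c, v)`. -/
noncomputable def boost (c : ℝ) (v : EuclideanSpace ℝ (Fin k)) :
    (ℝ × EuclideanSpace ℝ (Fin k)) →ₗ[ℝ] ℝ × EuclideanSpace ℝ (Fin k) where
  toFun x := (c * x.1 + inner ℝ v x.2,
    -- For `1 + c ≠ 0` the coefficient is the usual `x.1 + ⟨v, x.2⟩ / (1 + c)`. Written as the sum
    -- of the old and new times over `1 + c`, it is unchanged when passing to the inverse boost.
    x.2 + ((x.1 + (c * x.1 + inner ℝ v x.2)) / (1 + c)) • v)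
  map_add' x y := by
    refine Prod.ext ?_ ?_
    · simp only [Prod.fst_add, Prod.snd_add, inner_add_right]; ring
    · simp only [Prod.fst_add, Prod.snd_add, inner_add_right]
      module
  map_smul' r x := by
    refine Prod.ext ?_ ?_
    · simp only [Prod.smul_fst, Prod.smul_snd, inner_smul_right, smul_eq_mul, RingHom.id_apply]
      ring
    · simp only [Prod.smul_fst, Prod.smul_snd, inner_smul_right, smul_eq_mul, RingHom.id_apply]
      module

theorem boost_fst (c : ℝ) (v : EuclideanSpace ℝ (Fin k)) (x) :
    (boost c v x).1 = c * x.1 + inner ℝ v x.2 := rfl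

theorem boost_snd (c : ℝ) (v : EuclideanSpace ℝ (Fin k)) (x) :
    (boost c v x).2 = x.2 + ((x.1 + (c * x.1 + inner ℝ v x.2)) / (1 + c)) • v := rfl

theorem dot_boost {c : ℝ} (hc : 1 + c ≠ 0) (v : EuclideanSpace ℝ (Fin k)) (x y) :
    dot (boost c v x) y = dot x (boost c v y) := by
  simp only [dot, boost_fst, boost_snd, inner_add_left, inner_add_right, real_inner_smul_left,
    real_inner_smul_right, real_inner_comm v x.2]
  field_simp
  ring

theorem boost_neg_boost {c : ℝ} {v : EuclideanSpace ℝ (Fin k)} (hc : 0 ≤ c)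
    (hv : c ^ 2 = 1 + ‖v‖ ^ 2) (x) : boost c (-v) (boost c v x) = x := by
  have hc1 : 1 + c ≠ 0 := by positivity
  have hvv : inner ℝ v v = c ^ 2 - 1 := by rw [real_inner_self_eq_norm_sq]; linarith
  have h1 : (boost c (-v) (boost c v x)).1 = x.1 := by
    simp only [boost_fst, boost_snd, inner_add_right, inner_neg_left, real_inner_smul_right, hvv]
    field_simp
    ring
  refine Prod.ext h1 ?_
  rw [boost_snd, ← boost_fst, h1, boost_snd, boost_fst, smul_neg]
  module

/-- A boost preserves `t² - ‖x‖²`, and `‖v‖ ≤ c` keeps the time coordinate nonnegative. -/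
theorem boost_mem_lorentzCone {c : ℝ} {v : EuclideanSpace ℝ (Fin k)} (hc : 0 ≤ c)
    (hv : c ^ 2 = 1 + ‖v‖ ^ 2) : IsPositiveMap (lorentzCone k) (lorentzCone k) (boost c v) := by
  intro x hx
  rw [mem_lorentzCone] at hx ⊢
  have hc1 : 1 + c ≠ 0 := by positivity
  have hvv : inner ℝ v v = c ^ 2 - 1 := by rw [real_inner_self_eq_norm_sq]; linarith
  have h0 : 0 ≤ (boost c v x).1 := by
    rw [boost_fst]
    have h1 := (abs_le.mp (abs_real_inner_le_norm v x.2)).1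
    have h2 : ‖v‖ ≤ c := abs_le_of_sq_le_sq' (by linarith) hc |>.2
    have h3 := mul_le_mul h2 hx (norm_nonneg _) hc
    linarith
  have hsq : ‖(boost c v x).2‖ ^ 2 = ‖x.2‖ ^ 2 + (boost c v x).1 ^ 2 - x.1 ^ 2 := by
    rw [← real_inner_self_eq_norm_sq, ← real_inner_self_eq_norm_sq, boost_snd, boost_fst]
    simp only [inner_add_left, inner_add_right, real_inner_smul_left, real_inner_smul_right, hvv,
      real_inner_comm v x.2]
    field_simp
    ring
  have h4 : ‖x.2‖ ^ 2 ≤ x.1 ^ 2 := pow_le_pow_left₀ (norm_nonneg _) hx 2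
  exact abs_le_of_sq_le_sq' (by linarith) h0 |>.2

/-- For interior points `p`, `q` of the Lorentz cone there is a boost that makes `p` parallel to
the image of `q` under the inverse boost. -/
theorem exists_boost_eq_smul {p q : ℝ × EuclideanSpace ℝ (Fin k)} (hp : ‖p.2‖ < p.1)
    (hq : ‖q.2‖ < q.1) : ∃ (c : ℝ) (v : EuclideanSpace ℝ (Fin k)) (μ : ℝ), 0 ≤ c ∧
      c ^ 2 = 1 + ‖v‖ ^ 2 ∧ 0 < μ ∧ boost c v p = μ • boost c (-v) q := by
  have hunit : ∀ p : ℝ × EuclideanSpace ℝ (Fin k), ‖p.2‖ < p.1 →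
      ∃ (s : ℝ) (p' : ℝ × EuclideanSpace ℝ (Fin k)), 0 < s ∧ p = s • p' ∧ 0 < p'.1 ∧
        p'.1 ^ 2 - ‖p'.2‖ ^ 2 = 1 := by
    intro p hp
    have h1 : 0 < p.1 ^ 2 - ‖p.2‖ ^ 2 :=
      sub_pos.mpr (pow_lt_pow_left₀ hp (norm_nonneg _) two_ne_zero)
    set s := √(p.1 ^ 2 - ‖p.2‖ ^ 2) with hs
    have hs0 : 0 < s := Real.sqrt_pos.mpr h1
    have hs2 : s ^ 2 = p.1 ^ 2 - ‖p.2‖ ^ 2 := Real.sq_sqrt h1.le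
    refine ⟨s, s⁻¹ • p, hs0, by rw [smul_inv_smul₀ hs0.ne'], ?_, ?_⟩
    · exact mul_pos (inv_pos.mpr hs0) ((norm_nonneg _).trans_lt hp)
    · rw [Prod.smul_fst, Prod.smul_snd, norm_smul, mul_pow, smul_eq_mul, mul_pow, Real.norm_eq_abs,
        sq_abs, ← mul_sub, ← hs2]
      field_simp
  obtain ⟨s, p, hs, rfl, hp0, hp1⟩ := hunit p hp
  obtain ⟨r, q, hr, rfl, hq0, hq1⟩ := hunit q hq
  have hpp : inner ℝ p.2 p.2 = p.1 ^ 2 - 1 := by rw [real_inner_self_eq_norm_sq]; linarith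
  have hqq : inner ℝ q.2 q.2 = q.1 ^ 2 - 1 := by rw [real_inner_self_eq_norm_sq]; linarith
  set d := dot p q with hd
  have hdi : inner ℝ p.2 q.2 = d - p.1 * q.1 := by rw [hd, dot]; ring
  have hd0 : 0 ≤ d := by
    refine dot_nonneg ?_ ?_ <;> rw [mem_lorentzCone]
    · exact abs_le_of_sq_le_sq' (by linarith) hp0.le |>.2
    · exact abs_le_of_sq_le_sq' (by linarith) hq0.le |>.2
  have h2 : 0 < 2 + 2 * d := by linarith
  -- For `p`, `q` on the unit hyperboloid, `(p.1 + q.1, q.2 - p.2)` has Lorentz square `2 + 2 * d`.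
  -- Normalized by `κ`, it is the time direction of the boost whose square takes `p` to `q`.
  set κ := (√(2 + 2 * d))⁻¹ with hκ
  have hκ0 : 0 < κ := inv_pos.mpr (Real.sqrt_pos.mpr h2)
  have hκ2 : κ ^ 2 * (2 + 2 * d) = 1 := by
    rw [hκ, inv_pow, Real.sq_sqrt h2.le, inv_mul_cancel₀ h2.ne']
  have hc0 : 0 ≤ κ * (p.1 + q.1) := by positivity
  have hpar : boost (κ * (p.1 + q.1)) (κ • (q.2 - p.2)) p =
      boost (κ * (p.1 + q.1)) (-(κ • (q.2 - p.2))) q := by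
    have e1 : (boost (κ * (p.1 + q.1)) (κ • (q.2 - p.2)) p).1 = κ * (1 + d) := by
      rw [boost_fst, real_inner_smul_left, inner_sub_left, hpp, real_inner_comm, hdi]; ring
    have e2 : (boost (κ * (p.1 + q.1)) (-(κ • (q.2 - p.2))) q).1 = κ * (1 + d) := by
      rw [boost_fst, inner_neg_left, real_inner_smul_left, inner_sub_left, hqq, hdi]; ring
    refine Prod.ext (e1.trans e2.symm) ?_
    rw [boost_snd, boost_snd, ← boost_fst, ← boost_fst, e1, e2]
    have hne : 1 + κ * (p.1 + q.1) ≠ 0 := by positivity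
    have e3 : (p.1 + κ * (1 + d)) / (1 + κ * (p.1 + q.1)) * κ +
        (q.1 + κ * (1 + d)) / (1 + κ * (p.1 + q.1)) * κ = 1 := by
      field_simp
      linear_combination hκ2
    rw [smul_neg, smul_smul, smul_smul]
    linear_combination (norm := module) e3 • (q.2 - p.2)
  refine ⟨κ * (p.1 + q.1), κ • (q.2 - p.2), s * r⁻¹, hc0, ?_, by positivity, ?_⟩
  · rw [← real_inner_self_eq_norm_sq]
    simp only [real_inner_smul_left, real_inner_smul_right, inner_sub_left, inner_sub_right,
      hpp, hqq, real_inner_comm p.2 q.2, hdi]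
    linear_combination hκ2
  · rw [map_smul, map_smul, hpar, smul_smul, inv_mul_cancel_right₀ hr.ne']

/-! ### Duality for the minimal tensor product -/

/-- In a finite-dimensional space, the convex hull of a compact set is compact. -/
theorem isCompact_convexHull_of_isCompact {E : Type*} [NormedAddCommGroup E] [NormedSpace ℝ E]
    [FiniteDimensional ℝ E] {s : Set E} (hs : IsCompact s) : IsCompact (convexHull ℝ s) := by
  let f : (m : ℕ) → (Fin m → ℝ) × (Fin m → E) → E := fun m p => ∑ i, p.1 i • p.2 i
  have hf : ∀ m, Continuous (f m) := fun m => by fun_prop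
  have key : convexHull ℝ s = ⋃ m ∈ Set.Iic (Module.finrank ℝ E + 1),
      -- Carathéodory's theorem bounds the number of points, leaving finitely many compact images.
      f m '' (stdSimplex ℝ (Fin m) ×ˢ Set.univ.pi fun _ => s) := by
    refine Set.Subset.antisymm (fun x hx => ?_) (fun x hx => ?_)
    · obtain ⟨ι, _, z, w, hz, hind, hw, hw1, rfl⟩ := eq_pos_convex_span_of_mem_convexHull hx
      let e := Fintype.equivFin ι
      refine Set.mem_biUnion (x := Fintype.card ι) ?_
        ⟨(w ∘ e.symm, z ∘ e.symm), ⟨⟨fun i => (hw _).le, ?_⟩, fun i _ => hz ⟨_, rfl⟩⟩, ?_⟩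
      · exact hind.card_le_finrank_succ.trans (by gcongr; exact Submodule.finrank_le _)
      · rw [← hw1]; exact e.symm.sum_comp w
      · exact e.symm.sum_comp fun i => w i • z i
    · obtain ⟨m, -, p, ⟨hp1, hp2⟩, rfl⟩ := Set.mem_iUnion₂.mp hx
      exact (convex_convexHull ℝ s).sum_mem (fun i _ => hp1.1 i) hp1.2
        fun i _ => subset_convexHull ℝ s (hp2 i trivial)
  rw [key]
  exact (Set.finite_Iic _).isCompact_biUnion fun m _ =>
    ((isCompact_stdSimplex ℝ (Fin m)).prod (isCompact_univ_pi fun _ => hs)).image (hf m)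

/-- A conical hull with a compact base is determined by the linear functionals that are
nonnegative on the base. -/
theorem mem_hull_of_forall_nonneg {E : Type*} [NormedAddCommGroup E] [NormedSpace ℝ E]
    [FiniteDimensional ℝ E] {s : Set E} (hs : IsCompact s) (φ : E →ₗ[ℝ] ℝ)
    (hφ : ∀ x ∈ s, φ x = 1) {z : E} (hz : ∀ f : E →ₗ[ℝ] ℝ, (∀ x ∈ s, 0 ≤ f x) → 0 ≤ f z) :
    z ∈ PointedCone.hull ℝ s := by
  have hz0 : 0 ≤ φ z := hz φ fun x hx => by rw [hφ x hx]; exact zero_le_one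
  rcases hz0.eq_or_lt with h0 | h0
  · have : z = 0 := by
      rw [← Module.forall_dual_apply_eq_zero_iff ℝ]
      intro f
      -- For `C` large, `C • φ + g` is nonnegative on the bounded base, while `φ z = 0`.
      have hle : ∀ g : E →ₗ[ℝ] ℝ, 0 ≤ g z := by
        intro g
        obtain ⟨C, hC⟩ := hs.exists_bound_of_continuousOn
          (LinearMap.continuous_of_finiteDimensional g).continuousOn
        have := hz (C • φ + g) fun x hx => by
          have := (abs_le.mp (hC x hx)).1
          simp only [LinearMap.add_apply, LinearMap.smul_apply, hφ x hx, smul_eq_mul]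
          linarith
        simpa [← h0] using this
      exact le_antisymm (by simpa using hle (-f)) (hle f)
    rw [this]
    exact Submodule.zero_mem _
  · have hmem : (φ z)⁻¹ • z ∈ convexHull ℝ s := by
      by_contra hn
      obtain ⟨f, a, hf1, hf2⟩ := geometric_hahn_banach_closed_point (convex_convexHull ℝ s)
        (isCompact_convexHull_of_isCompact hs).isClosed hn
      have := hz (a • φ - f.toLinearMap) fun x hx => by
        have := hf1 x (subset_convexHull ℝ s hx)
        simp only [LinearMap.sub_apply, LinearMap.smul_apply, hφ x hx, smul_eq_mul,
          ContinuousLinearMap.coe_coe]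
        linarith
      simp only [LinearMap.sub_apply, LinearMap.smul_apply, smul_eq_mul,
        ContinuousLinearMap.coe_coe] at this
      rw [map_smul, smul_eq_mul, lt_inv_mul_iff₀ h0] at hf2
      linarith
    have hsub : convexHull ℝ s ⊆ PointedCone.hull ℝ s :=
      convexHull_min PointedCone.subset_hull (PointedCone.convex _)
    rw [← smul_inv_smul₀ h0.ne' z]
    exact PointedCone.smul_mem _ hz0 (hsub hmem)

/-- The minimal tensor product of two Lorentz cones is determined by the bilinear forms that are
nonnegative on the cones. -/
theorem mem_minTensorProduct_lorentzCone {n : ℕ}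
    {z : (ℝ × EuclideanSpace ℝ (Fin n)) ⊗[ℝ] (ℝ × EuclideanSpace ℝ (Fin n))}
    (hz : ∀ f : (ℝ × EuclideanSpace ℝ (Fin n)) ⊗[ℝ] (ℝ × EuclideanSpace ℝ (Fin n)) →ₗ[ℝ] ℝ,
      (∀ x ∈ lorentzCone n, ∀ y ∈ lorentzCone n, 0 ≤ f (x ⊗ₜ[ℝ] y)) → 0 ≤ f z) :
    z ∈ PointedCone.minTensorProduct (lorentzCone n) (lorentzCone n) := by
  let V := ℝ × EuclideanSpace ℝ (Fin n)
  let W := V ⊗[ℝ] V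
  let e : W ≃ₗ[ℝ] (Fin (Module.finrank ℝ W) → ℝ) := (Module.finBasis ℝ W).equivFun
  let K : Set V := {1} ×ˢ Metric.closedBall 0 1
  have hK : IsCompact K := isCompact_singleton.prod (isCompact_closedBall _ _)
  have hKL : ∀ x ∈ K, x ∈ lorentzCone n := by
    rintro ⟨t, x⟩ ⟨ht, hx⟩
    rw [mem_lorentzCone]
    exact (mem_closedBall_zero_iff.mp hx).trans (le_of_eq (Set.mem_singleton_iff.mp ht).symm)
  have hK1 : ∀ x ∈ lorentzCone n, ∃ t : ℝ, 0 ≤ t ∧ ∃ y ∈ K, x = t • y := by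
    rintro ⟨t, x⟩ hx
    rw [mem_lorentzCone] at hx
    have ht : 0 ≤ t := (norm_nonneg _).trans hx
    refine ⟨t, ht, (1, t⁻¹ • x), ⟨rfl, ?_⟩, ?_⟩
    · rw [mem_closedBall_zero_iff, norm_smul, norm_inv, Real.norm_of_nonneg ht]
      exact inv_mul_le_one_of_le₀ hx ht
    · rcases ht.eq_or_lt with h0 | h0
      · subst h0
        have : x = 0 := norm_le_zero_iff.mp hx
        simp [this]
      · exact Prod.ext (mul_one t).symm (smul_inv_smul₀ h0.ne' x).symm
  let B : V →ₗ[ℝ] V →ₗ[ℝ] (Fin (Module.finrank ℝ W) → ℝ) :=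
    (TensorProduct.mk ℝ V V).compr₂ e.toLinearMap
  let s : Set (Fin (Module.finrank ℝ W) → ℝ) := (fun p : V × V => B p.1 p.2) '' (K ×ˢ K)
  have hs : IsCompact s := by
    refine (hK.prod hK).image ?_
    have h : (fun p : V × V => B p.1 p.2) = fun p => B.toContinuousBilinearMap p.1 p.2 := rfl
    rw [h]
    fun_prop
  -- The product of the time coordinates equals `1` on tensors from the slice `K`, so these form a
  -- compact base.
  let φ : W →ₗ[ℝ] ℝ :=
    TensorProduct.lift ((LinearMap.mul ℝ ℝ).compl₁₂ (LinearMap.fst ℝ _ _) (LinearMap.fst ℝ _ _))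
  have hmem : e z ∈ PointedCone.hull ℝ s := by
    refine mem_hull_of_forall_nonneg hs (φ ∘ₗ e.symm.toLinearMap) ?_ ?_
    · rintro _ ⟨⟨x, y⟩, ⟨hx, hy⟩, rfl⟩
      have h1 : x.1 = 1 := hx.1
      have h2 : y.1 = 1 := hy.1
      have h3 : e.symm (B x y) = x ⊗ₜ[ℝ] y := e.symm_apply_apply _
      change φ (e.symm (B x y)) = 1
      rw [h3]
      change x.1 * y.1 = 1
      rw [h1, h2, one_mul]
    · intro f hf
      refine hz (f ∘ₗ e.toLinearMap) fun x hx y hy => ?_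
      obtain ⟨a, ha, x, hxK, rfl⟩ := hK1 x hx
      obtain ⟨b, hb, y, hyK, rfl⟩ := hK1 y hy
      have := hf (B x y) ⟨(x, y), ⟨hxK, hyK⟩, rfl⟩
      rw [TensorProduct.smul_tmul_smul, map_smul]
      exact mul_nonneg (mul_nonneg ha hb) this
  have hle : PointedCone.hull ℝ s ≤ PointedCone.comap e.symm.toLinearMap
      (PointedCone.minTensorProduct (lorentzCone n) (lorentzCone n)) := by
    refine Submodule.span_le.mpr ?_
    rintro _ ⟨⟨x, y⟩, ⟨hx, hy⟩, rfl⟩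
    have h : e.symm (B x y) = x ⊗ₜ[ℝ] y := e.symm_apply_apply _
    change e.symm (B x y) ∈ PointedCone.minTensorProduct (lorentzCone n) (lorentzCone n)
    rw [h]
    exact PointedCone.tmul_mem_minTensorProduct (hKL x hx) (hKL y hy)
  have := hle hmem
  rw [PointedCone.mem_comap] at this
  simpa using this

/-! ### The Cauchy–Schwarz inequality via boosts -/

theorem dot_add_left (x y z : ℝ × EuclideanSpace ℝ (Fin k)) :
    dot (x + y) z = dot x z + dot y z := by
  simp only [dot, Prod.fst_add, Prod.snd_add, inner_add_left]; ring

theorem dot_add_right (x y z : ℝ × EuclideanSpace ℝ (Fin k)) :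
    dot x (y + z) = dot x y + dot x z := by
  simp only [dot, Prod.fst_add, Prod.snd_add, inner_add_right]; ring

theorem dot_smul_left (r : ℝ) (x y : ℝ × EuclideanSpace ℝ (Fin k)) :
    dot (r • x) y = r * dot x y := by
  simp only [dot, Prod.smul_fst, Prod.smul_snd, real_inner_smul_left, smul_eq_mul]; ring

theorem dot_smul_right (r : ℝ) (x y : ℝ × EuclideanSpace ℝ (Fin k)) :
    dot x (r • y) = r * dot x y := by
  rw [dot_comm, dot_smul_left, dot_comm]

theorem sum_dot_mul_dot (x y : ℝ × EuclideanSpace ℝ (Fin k)) :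
    ∑ o, dot x (stdVec k o) * dot y (stdVec k o) = dot x y := by
  conv_rhs => rw [← sum_dot_stdVec_smul x, dot_sum_smul]
  exact Finset.sum_congr rfl fun o _ => by rw [dot_comm x, dot_comm y]

/-- A symmetric `H` can be moved to the second factor, where `H'` cancels it. -/
theorem map_identityTensor_eq_self {H H' : (ℝ × EuclideanSpace ℝ (Fin k)) →ₗ[ℝ] _}
    (hH : ∀ x y, dot (H x) y = dot x (H y)) (hH' : ∀ x, H' (H x) = x) :
    TensorProduct.map H H' (identityTensor k) = identityTensor k := by
  have h1 : TensorProduct.map H H' = TensorProduct.map LinearMap.id H' ∘ₗ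
      TensorProduct.map H LinearMap.id := by
    rw [← TensorProduct.map_comp, LinearMap.id_comp, LinearMap.comp_id]
  have h2 : H' ∘ₗ H = LinearMap.id := LinearMap.ext hH'
  rw [h1, LinearMap.comp_apply, map_identityTensor_comm hH, ← LinearMap.comp_apply,
    ← TensorProduct.map_comp, h2, LinearMap.id_comp, TensorProduct.map_id, LinearMap.id_apply]

theorem lift_map_identityTensor {V W : Type*} [AddCommGroup V] [Module ℝ V] [AddCommGroup W]
    [Module ℝ W] (f : V →ₗ[ℝ] W →ₗ[ℝ] ℝ) (A : (ℝ × EuclideanSpace ℝ (Fin k)) →ₗ[ℝ] V)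
    (B : (ℝ × EuclideanSpace ℝ (Fin k)) →ₗ[ℝ] W) :
    TensorProduct.lift f (TensorProduct.map A B (identityTensor k)) =
      ∑ o, f (A (stdVec k o)) (B (stdVec k o)) := by
  simp only [identityTensor_eq_sum, map_sum, TensorProduct.map_tmul, TensorProduct.lift.tmul]

/-- A Cauchy–Schwarz inequality for two maps into a Lorentz space whose Lorentzian
Hilbert–Schmidt forms are nonnegative after every positive change of variables. -/
theorem sum_inner_le_sum_mul {E : Type*} [NormedAddCommGroup E] [InnerProductSpace ℝ E]
    {T S : (ℝ × EuclideanSpace ℝ (Fin k)) →ₗ[ℝ] ℝ × E}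
    (hT0 : ∀ x ∈ lorentzCone k, 0 ≤ (T x).1) (hS0 : ∀ x ∈ lorentzCone k, 0 ≤ (S x).1)
    (hT : ∀ H, IsPositiveMap (lorentzCone k) (lorentzCone k) H →
      ∑ o, ‖(T (H (stdVec k o))).2‖ ^ 2 ≤ ∑ o, (T (H (stdVec k o))).1 ^ 2)
    (hS : ∀ H, IsPositiveMap (lorentzCone k) (lorentzCone k) H →
      ∑ o, ‖(S (H (stdVec k o))).2‖ ^ 2 ≤ ∑ o, (S (H (stdVec k o))).1 ^ 2) :
    ∑ o, inner ℝ (T (stdVec k o)).2 (S (stdVec k o)).2 ≤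
      ∑ o, (T (stdVec k o)).1 * (S (stdVec k o)).1 := by
  let t₀ := LinearMap.fst ℝ ℝ E ∘ₗ T
  let s₀ := LinearMap.fst ℝ ℝ E ∘ₗ S
  let a := repr t₀
  let b := repr s₀
  have hta : ∀ x, (T x).1 = dot a x := fun x => (dot_repr t₀ x).symm
  have hsb : ∀ x, (S x).1 = dot b x := fun x => (dot_repr s₀ x).symm
  have haL : a ∈ lorentzCone k := repr_mem_lorentzCone hT0
  have hbL : b ∈ lorentzCone k := repr_mem_lorentzCone hS0
  have hsum : ∑ o, (T (stdVec k o)).1 * (S (stdVec k o)).1 = dot a b := by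
    simp only [hta, hsb]; exact sum_dot_mul_dot a b
  rw [hsum]
  set e₀ : ℝ × EuclideanSpace ℝ (Fin k) := (1, 0) with he₀
  have he₀L : e₀ ∈ lorentzCone k := by simp [he₀, mem_lorentzCone]
  -- Adding `ε • e₀` makes the time vectors interior, as the choice of boost requires. It only
  -- enlarges the bound, since `H r` and `H e₀` lie in the cone and have nonnegative `dot`.
  have hbound : ∀ (R : (ℝ × EuclideanSpace ℝ (Fin k)) →ₗ[ℝ] ℝ × E)
      (H : (ℝ × EuclideanSpace ℝ (Fin k)) →ₗ[ℝ] _) (r : ℝ × EuclideanSpace ℝ (Fin k)) (ε : ℝ),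
      (∀ x, (R x).1 = dot r x) → r ∈ lorentzCone k → 0 ≤ ε →
      (∀ x y, dot (H x) y = dot x (H y)) → IsPositiveMap (lorentzCone k) (lorentzCone k) H →
      ∑ o, ‖(R (H (stdVec k o))).2‖ ^ 2 ≤ ∑ o, (R (H (stdVec k o))).1 ^ 2 →
      ∑ o, ‖(R (H (stdVec k o))).2‖ ^ 2 ≤ dot (H (r + ε • e₀)) (H (r + ε • e₀)) := by
    intro R H r ε hr hrL hε hsymm hpos hle
    refine hle.trans ?_
    have heq : ∑ o, (R (H (stdVec k o))).1 ^ 2 = dot (H r) (H r) := by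
      simp only [hr, ← hsymm r, sq, sum_dot_mul_dot]
    rw [heq, map_add, map_smul, dot_add_left, dot_add_right, dot_add_right, dot_smul_left,
      dot_smul_left, dot_smul_right, dot_smul_right]
    have h1 := mul_nonneg hε (dot_nonneg (hpos _ hrL) (hpos _ he₀L))
    have h2 := mul_nonneg hε (dot_nonneg (hpos _ he₀L) (hpos _ hrL))
    have h3 := mul_nonneg hε (mul_nonneg hε (dot_nonneg (hpos _ he₀L) (hpos _ he₀L)))
    linarith
  have key : ∀ ε : ℝ, 0 < ε → ∑ o, inner ℝ (T (stdVec k o)).2 (S (stdVec k o)).2 ≤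
      dot (a + ε • e₀) (b + ε • e₀) := by
    intro ε hε
    have hint : ∀ r ∈ lorentzCone k, ‖(r + ε • e₀).2‖ < (r + ε • e₀).1 := by
      intro r hr
      rw [mem_lorentzCone] at hr
      simp only [he₀, Prod.snd_add, Prod.smul_snd, smul_zero, add_zero, Prod.fst_add,
        Prod.smul_fst, smul_eq_mul, mul_one]
      linarith
    obtain ⟨c, v, μ, hc, hv, hμ, hpar⟩ := exists_boost_eq_smul (hint a haL) (hint b hbL)
    have hc1 : 1 + c ≠ 0 := by positivity
    have hv' : c ^ 2 = 1 + ‖-v‖ ^ 2 := by rwa [norm_neg]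
    set H := boost c v with hH
    set H' := boost c (-v)
    have hHpos := boost_mem_lorentzCone hc hv
    have hHpos' := boost_mem_lorentzCone hc hv'
    have hinv : ∀ x, H (H' x) = x := fun x => by
      simpa only [neg_neg] using boost_neg_boost hc hv' x
    have hchange : ∑ o, inner ℝ (T (stdVec k o)).2 (S (stdVec k o)).2 =
        ∑ o, inner ℝ (T (H (stdVec k o))).2 (S (H' (stdVec k o))).2 := by
      have h1 := lift_map_identityTensor ((innerₗ E).compl₁₂ (LinearMap.snd ℝ ℝ E ∘ₗ T)
        (LinearMap.snd ℝ ℝ E ∘ₗ S)) H H'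
      have h2 := lift_map_identityTensor ((innerₗ E).compl₁₂ (LinearMap.snd ℝ ℝ E ∘ₗ T)
        (LinearMap.snd ℝ ℝ E ∘ₗ S)) (LinearMap.id (M := ℝ × EuclideanSpace ℝ (Fin k)))
        LinearMap.id
      rw [map_identityTensor_eq_self (dot_boost hc1 v) (boost_neg_boost hc hv)] at h1
      rw [TensorProduct.map_id, LinearMap.id_apply] at h2
      exact h2.symm.trans h1
    rw [hchange]
    have hTb := hbound T H a ε hta haL hε.le (dot_boost hc1 v) hHpos (hT H hHpos)
    have hSb := hbound S H' b ε hsb hbL hε.le (dot_boost hc1 (-v)) hHpos' (hS H' hHpos')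
    set D := dot (H' (b + ε • e₀)) (H' (b + ε • e₀)) with hD
    rw [hpar, dot_smul_left, dot_smul_right] at hTb
    have hfin : dot (a + ε • e₀) (b + ε • e₀) = μ * D := by
      rw [hD, ← dot_smul_left, ← hpar, dot_boost hc1, ← hH, hinv]
    rw [hfin]
    -- The weight `μ` is the ratio of the parallel time vectors, so both time terms become `μ ^ 2 *
    -- D` and nothing is lost there.
    have hyoung : ∀ o, 2 * μ * inner ℝ (T (H (stdVec k o))).2 (S (H' (stdVec k o))).2 ≤
        ‖(T (H (stdVec k o))).2‖ ^ 2 + μ ^ 2 * ‖(S (H' (stdVec k o))).2‖ ^ 2 := by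
      intro o
      have h1 := real_inner_le_norm (T (H (stdVec k o))).2 (S (H' (stdVec k o))).2
      have h2 := mul_le_mul_of_nonneg_left h1 (show 0 ≤ 2 * μ by positivity)
      nlinarith [sq_nonneg (‖(T (H (stdVec k o))).2‖ - μ * ‖(S (H' (stdVec k o))).2‖)]
    have hsum2 := Finset.sum_le_sum fun o (_ : o ∈ Finset.univ) => hyoung o
    rw [← Finset.mul_sum, Finset.sum_add_distrib, ← Finset.mul_sum] at hsum2
    have h3 := mul_le_mul_of_nonneg_left hSb (sq_nonneg μ)
    refine le_of_mul_le_mul_left ?_ (show 0 < 2 * μ by positivity)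
    linarith
  have hlim : Filter.Tendsto (fun ε : ℝ => dot (a + ε • e₀) (b + ε • e₀))
      (nhdsWithin 0 (Set.Ioi 0)) (nhds (dot a b)) := by
    have hcont : Continuous fun ε : ℝ => dot (a + ε • e₀) (b + ε • e₀) := by
      unfold dot; fun_prop
    have := (hcont.tendsto 0).mono_left (nhdsWithin_le_nhds (s := Set.Ioi 0))
    simpa using this
  refine ge_of_tendsto hlim ?_
  filter_upwards [self_mem_nhdsWithin] with ε hε using key ε hε

/-! ### The diagonal inequality and positive maps -/

/-- The 2-summing inequality for the columns of a positive map from a Lorentz cone. -/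
theorem IsTwoSummingConstant.sum_sq_le {X Y : Type*} [NormedAddCommGroup X] [NormedSpace ℝ X]
    [NormedAddCommGroup Y] [NormedSpace ℝ Y] {u : X →ₗ[ℝ] Y} {C : ℝ}
    (hu : IsTwoSummingConstant u C) {A : (ℝ × EuclideanSpace ℝ (Fin k)) →ₗ[ℝ] ℝ × X}
    (hA : IsPositiveMap (lorentzCone k) (normCone X) A) :
    ∑ o, ‖u (A (stdVec k o)).2‖ ^ 2 ≤ ∑ o, (C * (A (stdVec k o)).1) ^ 2 := by
  let e := Fintype.equivFin (Option (Fin k))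
  have h := hu.2 _ fun i => (A (stdVec k (e.symm i))).2
  have h1 : ∑ i, ‖u (A (stdVec k (e.symm i))).2‖ ^ 2 = ∑ o, ‖u (A (stdVec k o)).2‖ ^ 2 :=
    e.symm.sum_comp fun o => ‖u (A (stdVec k o)).2‖ ^ 2
  rw [h1] at h
  have : Nonempty {f : X →L[ℝ] ℝ // ‖f‖ ≤ 1} := ⟨0, by simp⟩
  have hsup : (⨆ f : {f : X →L[ℝ] ℝ // ‖f‖ ≤ 1}, √(∑ i, |f.1 (A (stdVec k (e.symm i))).2| ^ 2)) ≤
      √(∑ o, (A (stdVec k o)).1 ^ 2) := by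
    refine ciSup_le fun f => Real.sqrt_le_sqrt ?_
    rw [e.symm.sum_comp fun o => |f.1 (A (stdVec k o)).2| ^ 2]
    let α := LinearMap.fst ℝ ℝ X ∘ₗ A
    let g := f.1.toLinearMap ∘ₗ LinearMap.snd ℝ ℝ X ∘ₗ A
    have hg : ∀ x ∈ lorentzCone k, |g x| ≤ α x := fun x hx =>
      ((f.1.le_opNorm _).trans (mul_le_of_le_one_left (norm_nonneg _) f.2)).trans (hA x hx)
    -- Since `|g| ≤ α` on the cone, self-duality applies to `α ± g`, and `(α + g)(α - g) = α² - g²`.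
    have := sum_mul_nonneg (α := α + g) (β := α - g)
      (fun x hx => by
        have := (abs_le.mp (hg x hx)).1
        simp only [LinearMap.add_apply]; linarith)
      (fun x hx => by
        have := (abs_le.mp (hg x hx)).2
        simp only [LinearMap.sub_apply]; linarith)
    rw [← sub_nonneg, ← Finset.sum_sub_distrib]
    refine this.trans (le_of_eq (Finset.sum_congr rfl fun o _ => ?_))
    change (α (stdVec k o) + g (stdVec k o)) * (α (stdVec k o) - g (stdVec k o)) =
      α (stdVec k o) ^ 2 - |g (stdVec k o)| ^ 2
    rw [sq_abs]; ring
  have h2 := h.trans (mul_le_mul_of_nonneg_left hsup hu.1)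
  have h3 := (Real.sqrt_le_left (mul_nonneg hu.1 (Real.sqrt_nonneg _))).mp h2
  rw [mul_pow, Real.sq_sqrt (Finset.sum_nonneg fun o _ => sq_nonneg _)] at h3
  simpa only [mul_pow, ← Finset.mul_sum] using h3

/-- The Lorentz form `s t - ⟨x, y⟩` on `ℝ × E`. -/
noncomputable def lorentzForm (E : Type*) [NormedAddCommGroup E] [InnerProductSpace ℝ E] :
    (ℝ × E) →ₗ[ℝ] (ℝ × E) →ₗ[ℝ] ℝ :=
  (LinearMap.mul ℝ ℝ).compl₁₂ (LinearMap.fst ℝ ℝ E) (LinearMap.fst ℝ ℝ E) -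
    (innerₗ E).compl₁₂ (LinearMap.snd ℝ ℝ E) (LinearMap.snd ℝ ℝ E)

theorem lorentzForm_apply {E : Type*} [NormedAddCommGroup E] [InnerProductSpace ℝ E]
    (x y : ℝ × E) : lorentzForm E x y = x.1 * y.1 - inner ℝ x.2 y.2 := rfl

theorem lorentzForm_self {E : Type*} [NormedAddCommGroup E] [InnerProductSpace ℝ E]
    (x : ℝ × E) : lorentzForm E x x = x.1 ^ 2 - ‖x.2‖ ^ 2 := by
  rw [lorentzForm_apply, real_inner_self_eq_norm_sq, sq x.1]

/-- Positive maps between Lorentz cones preserve nonnegativity of sums of the Lorentz form. -/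
theorem IsPositiveMap.sum_sq_le {n : ℕ} {ι : Type*} [Fintype ι]
    {Q : (ℝ × EuclideanSpace ℝ (Fin n)) →ₗ[ℝ] ℝ × EuclideanSpace ℝ (Fin n)}
    (hQ : IsPositiveMap (lorentzCone n) (lorentzCone n) Q)
    {y : ι → ℝ × EuclideanSpace ℝ (Fin n)} (hy : ∑ i, ‖(y i).2‖ ^ 2 ≤ ∑ i, (y i).1 ^ 2) :
    ∑ i, ‖(Q (y i)).2‖ ^ 2 ≤ ∑ i, (Q (y i)).1 ^ 2 := by
  obtain ⟨τ, hτ, hle⟩ := exists_mul_le_of_nonneg_imp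
    (lorentzForm (EuclideanSpace ℝ (Fin n)))
    ((lorentzForm (EuclideanSpace ℝ (Fin n))).compl₁₂ Q Q) ⟨(1, 0), by simp [lorentzForm_self]⟩
    (fun x hx => by
      have hmem : ∀ z ∈ lorentzCone n, 0 ≤ lorentzForm (EuclideanSpace ℝ (Fin n)) (Q z) (Q z) := by
        intro z hz
        rw [lorentzForm_self, sub_nonneg]
        exact pow_le_pow_left₀ (norm_nonneg _) (hQ z hz) 2
      rw [LinearMap.compl₁₂_apply]
      rw [lorentzForm_self, sub_nonneg, sq_le_sq, abs_norm] at hx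
      -- A vector with nonnegative Lorentz square lies in the cone up to sign.
      rcases abs_cases x.1 with ⟨h, -⟩ | ⟨h, -⟩
      · exact hmem x (by rw [mem_lorentzCone]; linarith)
      · have := hmem (-x) (by rw [mem_lorentzCone, Prod.snd_neg, norm_neg, Prod.fst_neg]; linarith)
        simpa using this)
  rw [← sub_nonneg, ← Finset.sum_sub_distrib] at hy ⊢
  refine (mul_nonneg hτ hy).trans ?_
  rw [Finset.mul_sum]
  refine Finset.sum_le_sum fun i _ => ?_
  have := hle (y i)
  rwa [LinearMap.compl₁₂_apply, lorentzForm_self, lorentzForm_self] at this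

/-- A bilinear form that is nonnegative on the Lorentz cone is the Lorentz form composed with a
positive map. -/
theorem exists_positive_lorentzForm_eq {n : ℕ}
    {f : (ℝ × EuclideanSpace ℝ (Fin n)) →ₗ[ℝ] (ℝ × EuclideanSpace ℝ (Fin n)) →ₗ[ℝ] ℝ}
    (hf : ∀ x ∈ lorentzCone n, ∀ y ∈ lorentzCone n, 0 ≤ f x y) :
    ∃ Q, IsPositiveMap (lorentzCone n) (lorentzCone n) Q ∧
      ∀ x y, f x y = lorentzForm (EuclideanSpace ℝ (Fin n)) (Q x) y := by
  -- The reflection `J` turns `dot` into the Lorentz form; it preserves the cone.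
  let J : (ℝ × EuclideanSpace ℝ (Fin n)) →ₗ[ℝ] ℝ × EuclideanSpace ℝ (Fin n) :=
    LinearMap.id.prodMap (-LinearMap.id)
  let R : (ℝ × EuclideanSpace ℝ (Fin n)) →ₗ[ℝ] ℝ × EuclideanSpace ℝ (Fin n) :=
    ∑ o, (f.flip (stdVec n o)).smulRight (stdVec n o)
  have hR : ∀ x, R x = repr (f x) := fun x => by simp [R, repr, LinearMap.sum_apply]
  refine ⟨J ∘ₗ R, fun x hx => ?_, fun x y => ?_⟩
  · have := repr_mem_lorentzCone (hf x hx)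
    rw [mem_lorentzCone] at this ⊢
    simpa [J, hR] using this
  · rw [← dot_repr (f x) y, ← hR, lorentzForm_apply]
    simp [J, dot]

/-! ### The two implications -/

theorem centralMap_fst {X Y : Type*} [AddCommGroup X] [Module ℝ X] [AddCommGroup Y] [Module ℝ Y]
    (c : ℝ) (u : X →ₗ[ℝ] Y) (x : ℝ × X) : (centralMap c u x).1 = c * x.1 := rfl

theorem centralMap_snd {X Y : Type*} [AddCommGroup X] [Module ℝ X] [AddCommGroup Y] [Module ℝ Y]
    (c : ℝ) (u : X →ₗ[ℝ] Y) (x : ℝ × X) : (centralMap c u x).2 = u x.2 := rfl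

variable {X : Type*} [NormedAddCommGroup X] [NormedSpace ℝ X] {n : ℕ}
  {u : X →ₗ[ℝ] EuclideanSpace ℝ (Fin n)} {c : ℝ}

theorem IsTwoSummingConstant.isPositiveMap_centralMap (hu : IsTwoSummingConstant u c) :
    IsPositiveMap (normCone X) (lorentzCone n) (centralMap c u) := by
  intro x hx
  change ‖x.2‖ ≤ x.1 at hx
  have h := hu.2 1 fun _ => x.2
  have : Nonempty {f : X →L[ℝ] ℝ // ‖f‖ ≤ 1} := ⟨0, by simp⟩
  have hsup : (⨆ f : {f : X →L[ℝ] ℝ // ‖f‖ ≤ 1}, √(∑ _i : Fin 1, |f.1 x.2| ^ 2)) ≤ x.1 := by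
    refine ciSup_le fun f => ?_
    simp only [Finset.univ_unique, Finset.sum_singleton, sq_abs, Real.sqrt_sq_eq_abs]
    exact ((f.1.le_opNorm _).trans (mul_le_of_le_one_left (norm_nonneg _) f.2)).trans hx
  simp only [Finset.univ_unique, Finset.sum_singleton, Real.sqrt_sq (norm_nonneg _)] at h hsup
  rw [mem_lorentzCone, centralMap_fst, centralMap_snd]
  exact h.trans (mul_le_mul_of_nonneg_left hsup hu.1)

theorem IsTwoSummingConstant.isLorentzEntanglementAnnihilating
    (hu : IsTwoSummingConstant u c) :
    IsLorentzEntanglementAnnihilating (normCone X) (lorentzCone n) (centralMap c u) := by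
  have hP := hu.isPositiveMap_centralMap
  refine ⟨hP, fun z hz => ?_⟩
  have hconv : Convex ℝ ((TensorProduct.map (centralMap c u) (centralMap c u)) ⁻¹'
      (PointedCone.minTensorProduct (lorentzCone n) (lorentzCone n) : Set _)) :=
    (PointedCone.convex _).linear_preimage _
  refine convexHull_min ?_ hconv hz
  rintro _ ⟨k, A, B, hA, hB, rfl⟩
  refine mem_minTensorProduct_lorentzCone fun f hf => ?_
  obtain ⟨Q, hQ, hfQ⟩ := exists_positive_lorentzForm_eq
    (f := (TensorProduct.mk ℝ _ _).compr₂ f) fun x hx y hy => hf x hx y hy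
  have hf_eq : f = TensorProduct.lift ((lorentzForm (EuclideanSpace ℝ (Fin n))).comp Q) :=
    TensorProduct.ext' hfQ
  have hK : ∀ {A : (ℝ × EuclideanSpace ℝ (Fin k)) →ₗ[ℝ] ℝ × X},
      IsPositiveMap (lorentzCone k) (normCone X) A →
      ∀ H, IsPositiveMap (lorentzCone k) (lorentzCone k) H →
      ∑ o, ‖(centralMap c u (A (H (stdVec k o)))).2‖ ^ 2 ≤
        ∑ o, (centralMap c u (A (H (stdVec k o)))).1 ^ 2 := fun hA H hH =>
    hu.sum_sq_le (A := _ ∘ₗ H) fun x hx => hA _ (hH x hx)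
  -- `Q` is absorbed into one factor. The diagonal hypotheses hold after any positive `H` because `A
  -- ∘ H` and `B ∘ H` are again positive.
  have hmain := sum_inner_le_sum_mul (T := Q ∘ₗ centralMap c u ∘ₗ A) (S := centralMap c u ∘ₗ B)
    (fun x hx => (norm_nonneg _).trans (hQ _ (hP _ (hA x hx))))
    (fun x hx => (norm_nonneg _).trans (hP _ (hB x hx)))
    (fun H hH => hQ.sum_sq_le (hK hA H hH)) (hK hB)
  rw [← LinearMap.comp_apply (TensorProduct.map _ _), ← TensorProduct.map_comp, hf_eq, lift_map_identityTensor]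
  rw [← sub_nonneg, ← Finset.sum_sub_distrib] at hmain
  exact hmain

/-- A norming functional of the sum reduces this to Cauchy–Schwarz in `ℝᵐ`; it bounds the operator
`ℓ₂ᵐ → X` sending `eᵢ` to `xᵢ`. -/
theorem norm_sum_smul_le {m : ℕ} (x : Fin m → X) (v : EuclideanSpace ℝ (Fin m)) :
    ‖∑ i, v i • x i‖ ≤
      (⨆ f : {f : X →L[ℝ] ℝ // ‖f‖ ≤ 1}, √(∑ i, |f.1 (x i)| ^ 2)) * ‖v‖ := by
  obtain ⟨g, hg, hgx⟩ := exists_dual_vector'' ℝ (∑ i, v i • x i)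
  have hbdd : BddAbove (Set.range
      fun f : {f : X →L[ℝ] ℝ // ‖f‖ ≤ 1} => √(∑ i, |f.1 (x i)| ^ 2)) := by
    refine ⟨√(∑ i, ‖x i‖ ^ 2), ?_⟩
    rintro _ ⟨f, rfl⟩
    refine Real.sqrt_le_sqrt (Finset.sum_le_sum fun i _ => ?_)
    refine pow_le_pow_left₀ (abs_nonneg _) ?_ 2
    exact (f.1.le_opNorm (x i)).trans (mul_le_of_le_one_left (norm_nonneg _) f.2)
  have h1 := le_ciSup hbdd ⟨g, hg⟩
  have h2 := Real.sum_mul_le_sqrt_mul_sqrt Finset.univ (fun i => v i) fun i => g (x i)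
  have h3 : ‖∑ i, v i • x i‖ = ∑ i, v i * g (x i) := by
    rw [RCLike.ofReal_real_eq_id, id] at hgx
    rw [← hgx, map_sum]
    simp only [map_smul, smul_eq_mul]
  have h4 : ‖v‖ = √(∑ i, v i ^ 2) := by
    rw [EuclideanSpace.norm_eq]; simp only [Real.norm_eq_abs, sq_abs]
  rw [h3, h4, mul_comm]
  refine h2.trans (mul_le_mul_of_nonneg_left ?_ (Real.sqrt_nonneg _))
  simpa only [sq_abs] using h1

theorem lorentzForm_nonneg_of_mem_minTensorProduct
    {z : (ℝ × EuclideanSpace ℝ (Fin n)) ⊗[ℝ] (ℝ × EuclideanSpace ℝ (Fin n))}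
    (hz : z ∈ PointedCone.minTensorProduct (lorentzCone n) (lorentzCone n)) :
    0 ≤ TensorProduct.lift (lorentzForm (EuclideanSpace ℝ (Fin n))) z := by
  have hle : PointedCone.minTensorProduct (lorentzCone n) (lorentzCone n) ≤
      PointedCone.comap (TensorProduct.lift (lorentzForm (EuclideanSpace ℝ (Fin n))))
        (PointedCone.positive ℝ ℝ) := by
    refine Submodule.span_le.mpr ?_
    rintro _ ⟨x, hx, y, hy, rfl⟩
    change 0 ≤ x.1 * y.1 - inner ℝ x.2 y.2
    have h1 := real_inner_le_norm x.2 y.2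
    have h2 := mul_le_mul hx hy (norm_nonneg _) ((norm_nonneg _).trans hx)
    linarith
  exact hle hz

theorem IsLorentzEntanglementAnnihilating.isTwoSummingConstant
    (h : IsLorentzEntanglementAnnihilating (normCone X) (lorentzCone n) (centralMap c u)) :
    IsTwoSummingConstant u c := by
  have hc : 0 ≤ c := by
    have h0 := h.1 (1, 0) (by change ‖(0 : X)‖ ≤ 1; simp)
    rw [mem_lorentzCone, centralMap_fst, mul_one] at h0
    exact (norm_nonneg _).trans h0
  refine ⟨hc, fun m x => ?_⟩
  set s := ⨆ f : {f : X →L[ℝ] ℝ // ‖f‖ ≤ 1}, √(∑ i, |f.1 (x i)| ^ 2)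
  have hs0 : 0 ≤ s := Real.iSup_nonneg fun f => Real.sqrt_nonneg _
  let D : EuclideanSpace ℝ (Fin m) →ₗ[ℝ] X :=
    ∑ i, (EuclideanSpace.proj i : EuclideanSpace ℝ (Fin m) →L[ℝ] ℝ).toLinearMap.smulRight (x i)
  have hD : ∀ v, D v = ∑ i, v i • x i := fun v => by simp [D, LinearMap.sum_apply]
  have hDi : ∀ i, D (EuclideanSpace.single i 1) = x i := fun i => by
    simp [hD]
  have hA : IsPositiveMap (lorentzCone m) (normCone X) (centralMap s D) := by
    intro v hv
    change ‖D v.2‖ ≤ s * v.1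
    rw [hD]
    exact (norm_sum_smul_le x v.2).trans (mul_le_mul_of_nonneg_left hv hs0)
  have hmem := lorentzForm_nonneg_of_mem_minTensorProduct
    (h.2 _ (subset_convexHull ℝ _ ⟨m, centralMap s D, centralMap s D, hA, hA, rfl⟩))
  rw [← LinearMap.comp_apply (TensorProduct.map _ _), ← TensorProduct.map_comp,
    lift_map_identityTensor, Fintype.sum_option] at hmem
  -- The column of `e₀` contributes `(c * s) ^ 2`, and that of each `eᵢ` contributes `-‖u (x i)‖ ^
  -- 2`.
  simp only [lorentzForm_self, stdVec, LinearMap.comp_apply, centralMap_fst, centralMap_snd, hDi,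
    map_zero, norm_zero, mul_one, mul_zero, ne_eq, OfNat.ofNat_ne_zero, not_false_eq_true,
    zero_pow, sub_zero, zero_sub, Finset.sum_neg_distrib] at hmem
  exact Real.sqrt_le_iff.mpr ⟨mul_nonneg hc hs0, by linarith⟩

end LorentzEntanglement

theorem mainTheorem1 {X : Type*} [NormedAddCommGroup X] [NormedSpace ℝ X]
    [FiniteDimensional ℝ X] (n : ℕ) (u : X →ₗ[ℝ] EuclideanSpace ℝ (Fin n)) (lam : ℝ) :
    LorentzEntanglement.IsLorentzEntanglementAnnihilating
        (LorentzEntanglement.normCone X) (LorentzEntanglement.lorentzCone n)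
        (LorentzEntanglement.centralMap lam u) ↔
      LorentzEntanglement.twoSummingNorm u ≤ lam := by
  have hleast := LorentzEntanglement.isLeast_twoSummingNorm u
  refine ⟨fun h => hleast.2 h.isTwoSummingConstant, fun h => ?_⟩
  have hmem : LorentzEntanglement.IsTwoSummingConstant u (LorentzEntanglement.twoSummingNorm u) := hleast.1
  exact LorentzEntanglement.IsTwoSummingConstant.isLorentzEntanglementAnnihilating
    ⟨hmem.1.trans h, fun m x => (hmem.2 m x).trans
      (mul_le_mul_of_nonneg_right h (Real.iSup_nonneg fun f => Real.sqrt_nonneg _))⟩
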